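/- Let $p$ be a prime and $\Delta$ a finite set. Put $E_\Delta^+=\mathbb{F}_p[[X_\alpha\mid\alpha\in\Delta]]$, $X_\Delta=\prod_{\alpha\in\Delta}X_\alpha$ and $E_\Delta=E_\Delta^+[X_\Delta^{-1}]$, and give $E_\Delta$ the $X_\Delta$-adic topology, i.e. the ring topology for which the subgroups $X_\Delta^nE_\Delta^+$ ($n\ge 0$) form a basis of neighbourhoods of $0$. Let $T_{+,\Delta}=\prod_{\alpha\in\Delta}\varphi_\alpha^{\mathbb{N}}\Gamma_\alpha$, where $\chi_\alpha\colon\Gamma_\alpha\cong\mathbb{Z}_p^\times$, act on $E_\Delta$ by ring endomorphisms through $$\varphi_\alpha(X_\alpha)=X_\alpha^p,\qquad \gamma_\alpha(X_\alpha)=(1+X_\alpha)^{\chi_\alpha(\gamma_\alpha)}-1\ (\gamma_\alpha\in\Gamma_\alpha),\qquad \varphi_\alpha(X_\beta)=\gamma_\alpha(X_\beta)=X_\beta\ (\beta\ne\alpha)$$ (substitution of power series, extended to $E_\Delta$). Let $D$ be an étale $(\varphi_\Delta,\Gamma_\Delta)$-module over $E_\Delta$, i.e. a finitely generated $E_\Delta$-module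 with a semilinear action $(\varphi_t)_{t\in T_{+,\Delta}}$ of the monoid $T_{+,\Delta}$ such that the map $\mathrm{id}\otimes\varphi_t\colon E_\Delta\otimes_{E_\Delta,\varphi_t}D\to D$ is an isomorphism for every $t\in T_{+,\Delta}$. Endow $D$ with its $X_\Delta$-adic topology, i.e. its module topology over the topological ring $E_\Delta$. Put $\varphi_s=\prod_{\alpha\in\Delta}\varphi_\alpha\in T_{+,\Delta}$ and $$D^{++}=\{x\in D\mid \lim_{k\to\infty}\varphi_s^k(x)=0\}.$$ Then $D^{++}$ is a finitely generated $E_\Delta^+$-submodule of $D$, it is stable under the action of $T_{+,\Delta}$, and $D=D^{++}[X_\Delta^{-1}]$, i.e. the inclusion $D^{++}\subseteq D$ exhibits $D$ as the localization of the $E_\Delta^+$-module $D^{++}$ at the powers of $X_\Delta$. -/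

import Mathlib

open Filter

noncomputable section

namespace MultiPhiGamma

/-! ### The rings `E_Δ^+` and `E_Δ` -/

/-- `E_Δ^+ = 𝔽_p⟦X_α ∣ α ∈ Δ⟧`. -/
abbrev EPlus (p : ℕ) (Δ : Type*) : Type _ := MvPowerSeries Δ (ZMod p)

/-- `X_Δ = ∏_{α ∈ Δ} X_α`. -/
def XΔ (p : ℕ) (Δ : Type*) [Fintype Δ] : EPlus p Δ :=
  ∏ α : Δ, (MvPowerSeries.X α : EPlus p Δ)

/-- `E_Δ = E_Δ^+[X_Δ⁻¹]`. -/
abbrev E (p : ℕ) (Δ : Type*) [Fintype Δ] : Type _ := Localization.Away (XΔ p Δ)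

/-- The additive subgroup `X_Δ^n E_Δ^+` of `E_Δ`. -/
def powSubgroup (p : ℕ) (Δ : Type*) [Fintype Δ] (n : ℕ) : AddSubgroup (E p Δ) :=
  (Ideal.span {XΔ p Δ ^ n}).toAddSubgroup.map (algebraMap (EPlus p Δ) (E p Δ)).toAddMonoidHom

theorem mem_powSubgroup {p : ℕ} {Δ : Type*} [Fintype Δ] {n : ℕ} {x : E p Δ} :
    x ∈ powSubgroup p Δ n ↔
      ∃ a : EPlus p Δ, x = algebraMap (EPlus p Δ) (E p Δ) (XΔ p Δ ^ n * a) := by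
  constructor
  · rintro ⟨y, hy, rfl⟩
    obtain ⟨a, rfl⟩ := Ideal.mem_span_singleton.1 hy
    exact ⟨a, rfl⟩
  · rintro ⟨a, rfl⟩
    exact ⟨_, Ideal.mem_span_singleton.2 ⟨a, rfl⟩, rfl⟩

theorem powSubgroup_basis (p : ℕ) (Δ : Type*) [Fintype Δ] :
    RingSubgroupsBasis (powSubgroup p Δ) := by
  refine RingSubgroupsBasis.of_comm _ ?_ ?_ ?_
  · intro i j
    refine ⟨i + j, fun x hx => ?_⟩
    obtain ⟨a, rfl⟩ := mem_powSubgroup.1 hx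
    refine ⟨mem_powSubgroup.2 ⟨XΔ p Δ ^ j * a, ?_⟩, mem_powSubgroup.2 ⟨XΔ p Δ ^ i * a, ?_⟩⟩
    · congr 1; ring
    · congr 1; ring
  · intro i
    refine ⟨i, ?_⟩
    rintro _ ⟨x, hx, y, hy, rfl⟩
    obtain ⟨a, rfl⟩ := mem_powSubgroup.1 hx
    obtain ⟨b, rfl⟩ := mem_powSubgroup.1 hy
    refine mem_powSubgroup.2 ⟨a * (XΔ p Δ ^ i * b), ?_⟩
    simp only [← map_mul]
    congr 1; ring
  · intro x i
    obtain ⟨n, a, hx⟩ := IsLocalization.Away.surj (XΔ p Δ) x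
    refine ⟨i + n, fun y hy => ?_⟩
    obtain ⟨b, rfl⟩ := mem_powSubgroup.1 hy
    refine mem_powSubgroup.2 ⟨a * b, ?_⟩
    simp only [map_mul, map_pow, pow_add] at hx ⊢
    rw [← hx]
    ring

/-- The `X_Δ`-adic topology on `E_Δ`: the ring topology for which the `X_Δ^n E_Δ^+`, `n ≥ 0`,
form a basis of neighbourhoods of `0`. -/
@[reducible] def topE (p : ℕ) (Δ : Type*) [Fintype Δ] : TopologicalSpace (E p Δ) :=
  (powSubgroup_basis p Δ).topology

/-- The `X_Δ`-adic topology on an `E_Δ`-module: the module topology over the topological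
ring `E_Δ`. -/
@[reducible] def topModule (p : ℕ) (Δ : Type*) [Fintype Δ] (D : Type*) [AddCommGroup D] [Module (E p Δ) D] :
    TopologicalSpace D :=
  letI := topE p Δ
  moduleTopology (E p Δ) D

/-! ### The monoid `T_{+,Δ}` and its action on `E_Δ` -/

/-- `T_{+,Δ} = ∏_{α ∈ Δ} φ_α^ℕ Γ_α`, where each `Γ_α` is identified with `ℤ_p^×` by `χ_α`. -/
abbrev TPlus (p : ℕ) [Fact p.Prime] (Δ : Type*) : Type _ := Δ → Multiplicative ℕ × ℤ_[p]ˣ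

/-- The power series `(1 + X)^c - 1 ∈ 𝔽_p⟦X⟧` for `c ∈ ℤ_p`. -/
def binom (p : ℕ) [Fact p.Prime] (c : ℤ_[p]) : PowerSeries (ZMod p) :=
  (PowerSeries.binomialSeries ℤ_[p] c).map PadicInt.toZMod - 1

/-- The image `φ_α^n(γ_α(X_α)) = ((1 + X_α)^{χ_α(γ_α)} - 1)^{p^n}` of `X_α` under the element `t`
of `T_{+,Δ}` whose component at `α` is `φ_α^n γ_α`. -/
def imageX {p : ℕ} [Fact p.Prime] {Δ : Type*} (t : TPlus p Δ) (α : Δ) : EPlus p Δ :=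
  ((binom p ((t α).2 : ℤ_[p])).subst (MvPowerSeries.X α : EPlus p Δ)) ^
    p ^ (Multiplicative.toAdd (t α).1)

theorem exists_imageX_eq {p : ℕ} [Fact p.Prime] {Δ : Type*} (t : TPlus p Δ) (α : Δ) :
    ∃ v : EPlus p Δ, IsUnit v ∧
      imageX t α = (MvPowerSeries.X α * v) ^ p ^ (Multiplicative.toAdd (t α).1) := by
  obtain ⟨u, hu⟩ : (PowerSeries.X : PowerSeries (ZMod p)) ∣ binom p ((t α).2 : ℤ_[p]) := by
    rw [PowerSeries.X_dvd_iff]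
    rw [← PowerSeries.coeff_zero_eq_constantCoeff_apply, binom, map_sub, PowerSeries.coeff_map,
      PowerSeries.binomialSeries_coeff, Ring.choose_zero_right, one_smul, map_one,
      PowerSeries.coeff_zero_one, sub_self]
  have hs : PowerSeries.HasSubst (MvPowerSeries.X α : EPlus p Δ) :=
    PowerSeries.HasSubst.of_constantCoeff_zero (MvPowerSeries.constantCoeff_X α)
  have hunit : IsUnit u := by
    rw [PowerSeries.isUnit_iff_constantCoeff]
    have h1 : PowerSeries.coeff 1 (binom p ((t α).2 : ℤ_[p])) = PowerSeries.constantCoeff u := by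
      rw [hu, ← PowerSeries.coeff_zero_eq_constantCoeff_apply]
      exact PowerSeries.coeff_succ_X_mul 0 u
    rw [← h1]
    have h2 : PowerSeries.coeff 1 (binom p ((t α).2 : ℤ_[p]))
        = PadicInt.toZMod ((t α).2 : ℤ_[p]) := by
      simp [binom, PowerSeries.coeff_one]
    rw [h2]
    exact (t α).2.isUnit.map PadicInt.toZMod
  refine ⟨u.subst (MvPowerSeries.X α : EPlus p Δ), ?_, ?_⟩
  · have := hunit.map (PowerSeries.substAlgHom (R := ZMod p) hs)
    rwa [PowerSeries.coe_substAlgHom] at this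
  · rw [imageX, hu, PowerSeries.subst_mul hs, PowerSeries.subst_X hs]

theorem hasSubst_imageX {p : ℕ} [Fact p.Prime] {Δ : Type*} [Fintype Δ] (t : TPlus p Δ) :
    MvPowerSeries.HasSubst (imageX t) := by
  refine MvPowerSeries.hasSubst_of_constantCoeff_zero fun α => ?_
  obtain ⟨v, -, hv⟩ := exists_imageX_eq t α
  rw [hv]
  simp [(Fact.out : p.Prime).ne_zero]

/-- The endomorphism `φ_t` of `E_Δ^+`: substitution of `imageX t α` for each variable `X_α`. -/
def sigmaPlus {p : ℕ} [Fact p.Prime] {Δ : Type*} [Fintype Δ] (t : TPlus p Δ) :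
    EPlus p Δ →+* EPlus p Δ :=
  (MvPowerSeries.substAlgHom (R := ZMod p) (hasSubst_imageX t)).toRingHom

theorem isUnit_sigmaPlus_XΔ {p : ℕ} [Fact p.Prime] {Δ : Type*} [Fintype Δ] (t : TPlus p Δ) :
    IsUnit (((algebraMap (EPlus p Δ) (E p Δ)).comp (sigmaPlus t)) (XΔ p Δ)) := by
  have hX : ∀ α : Δ, IsUnit (algebraMap (EPlus p Δ) (E p Δ) (MvPowerSeries.X α)) := by
    rw [← IsUnit.prod_univ_iff, ← map_prod]
    exact IsLocalization.Away.algebraMap_isUnit (XΔ p Δ)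
  change IsUnit (((algebraMap (EPlus p Δ) (E p Δ)).comp (sigmaPlus t))
    (∏ α : Δ, MvPowerSeries.X α))
  rw [map_prod, IsUnit.prod_univ_iff]
  intro α
  obtain ⟨v, hvu, hv⟩ := exists_imageX_eq t α
  have h : sigmaPlus t (MvPowerSeries.X α) = imageX t α :=
    MvPowerSeries.substAlgHom_X (hasSubst_imageX t) α
  rw [RingHom.comp_apply, h, hv, map_pow, map_mul]
  exact ((hX α).mul (hvu.map _)).pow _

/-- The endomorphism `φ_t` of `E_Δ`: the extension of `sigmaPlus t` to `E_Δ = E_Δ^+[X_Δ⁻¹]`. -/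
def sigma {p : ℕ} [Fact p.Prime] {Δ : Type*} [Fintype Δ] (t : TPlus p Δ) :
    E p Δ →+* E p Δ :=
  IsLocalization.Away.lift (XΔ p Δ) (isUnit_sigmaPlus_XΔ t)

/-- `φ_s = ∏_{α ∈ Δ} φ_α ∈ T_{+,Δ}`. -/
def phiS (p : ℕ) [Fact p.Prime] (Δ : Type*) : TPlus p Δ :=
  fun _ => (Multiplicative.ofAdd 1, 1)

/-! ### Étale modules -/

/-- For a ring homomorphism `σ : R → S` and a `σ`-semilinear map `f : M → N`, the statement that
the linearisation `id ⊗ f : S ⊗_{R,σ} M → N`, `s ⊗ m ↦ s • f m`, is an isomorphism. -/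
def LinearizationIsIso {R S M N : Type*} [CommRing R] [CommRing S] [AddCommGroup M]
    [AddCommGroup N] [Module R M] [Module S N] {σ : R →+* S} (f : M →ₛₗ[σ] N) : Prop :=
  letI : Algebra R S := σ.toAlgebra
  letI : Module R N := Module.compHom N σ
  haveI : IsScalarTower R S N := ⟨fun r s x => mul_smul (σ r) s x⟩
  let g : M →ₗ[R] N :=
    { toFun := f
      map_add' := map_add f
      map_smul' := fun r m => f.map_smulₛₗ r m }
  IsBaseChange S g

/-- The structure of an étale `(φ_Δ, Γ_Δ)`-module over `E_Δ` on an `E_Δ`-module `D`. -/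
structure EtaleModule (p : ℕ) [Fact p.Prime] (Δ : Type*) [Fintype Δ]
    (D : Type*) [AddCommGroup D] [Module (E p Δ) D] where
  /-- `D` is finitely generated over `E_Δ`. -/
  finite : Module.Finite (E p Δ) D
  /-- The semilinear action of `T_{+,Δ}` on `D`. -/
  φ : (t : TPlus p Δ) → D →ₛₗ[sigma t] D
  φ_one : ∀ x : D, φ 1 x = x
  φ_mul : ∀ (t u : TPlus p Δ) (x : D), φ (t * u) x = φ t (φ u x)
  /-- `id ⊗ φ_t : E_Δ ⊗_{E_Δ, φ_t} D → D` is an isomorphism for every `t`. -/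
  etale : ∀ t : TPlus p Δ, LinearizationIsIso (φ t)

/-- `D^{++} = {x ∈ D ∣ φ_s^k(x) → 0 as k → ∞}` for the `X_Δ`-adic topology on `D`. -/
def EtaleModule.plusPlus {p : ℕ} [Fact p.Prime] {Δ : Type*} [Fintype Δ]
    {D : Type*} [AddCommGroup D] [Module (E p Δ) D] (S : EtaleModule p Δ D) : Set D :=
  {x | Tendsto (fun k : ℕ => (S.φ (phiS p Δ))^[k] x) atTop (@nhds D (topModule p Δ D) 0)}

end MultiPhiGamma

end

open MultiPhiGamma

open Filter

noncomputable section
namespace MultiPhiGamma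

/-! ### Frobenius splittings -/

section Splitting

/-! Fix generators `e` of `D` and let `L` be their `E_Δ^+`-span; the subgroups `X_Δ^n L` form a
basis of neighbourhoods of `0`. On `E_Δ^+` the map `φ_s` is the `p`-th power, so it contracts
`X_Δ`-adically, and `D^{++}` gets trapped between two multiples of `L`.

Lower bound (`exists_pow_smul_mem_plusPlus`): `X_Δ^N φ_s(L) ⊆ L` for some `N`, and then
`φ_s^k(X_Δ^{N+1} L) ⊆ X_Δ^{N+1+k} L`. Hence `X_Δ^{N+1} L ⊆ D^{++}`, which gives the localization
statement.

Upper bound (`exists_pow_smul_mem_of_mem_plusPlus`): keeping only exponents divisible by `p` splits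
Frobenius on `E_Δ^+`. The splitting extends to `E_Δ` and, by étaleness, to an additive left inverse
`Ψ` of `φ_s` on `D` that preserves `X_Δ^{-M} L` for some `M`. If `φ_s^k(x)` lies in `L`, applying
`Ψ` `k` times puts `x` in `X_Δ^{-M} L`. Finite generation follows since `E_Δ^+` is noetherian.

Stability under `φ_t` holds because `φ_t` commutes with `φ_s`, sends `L` into some `X_Δ^{-N} L`, and
`X_Δ` divides `φ_t(X_Δ)`. -/

theorem exists_splitting_localization {R A : Type*} [CommRing R] [CommRing A] [Algebra R A]
    (x : R) [IsLocalization.Away x A] {p : ℕ} (hp : 1 ≤ p) {σ : R →+* R} (hσ : σ x = x ^ p)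
    {τ : A →+* A} (hτ : ∀ a, τ (algebraMap R A a) = algebraMap R A (σ a))
    (ψ : R →+ R) (hψ : ∀ a b, ψ (σ a * b) = a * ψ b) :
    ∃ Ψ : A →+ A, (∀ a, Ψ (algebraMap R A a) = algebraMap R A (ψ a)) ∧
      ∀ z b, Ψ (τ z * b) = z * Ψ b := by
  have hx : ∀ n, IsUnit (algebraMap R A (x ^ n)) := fun n => by
    rw [map_pow]
    exact (IsLocalization.Away.algebraMap_isUnit x).pow n
  -- Since `σ x = x ^ p`, denominators can be taken of the form `σ (x ^ n)`; semilinearity then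
  -- forces the value `ψ a / x ^ n`.
  have hden : ∀ z : A, ∃ (n : ℕ) (a : R), algebraMap R A (σ (x ^ n)) * z = algebraMap R A a := by
    intro z
    obtain ⟨n, a, h⟩ := IsLocalization.Away.surj x z
    refine ⟨n, x ^ (p * n - n) * a, ?_⟩
    rw [map_mul, ← h, map_pow, hσ, ← pow_mul,
      show p * n = (p * n - n) + n from (Nat.sub_add_cancel (Nat.le_mul_of_pos_left n hp)).symm,
      pow_add, Nat.add_sub_cancel]
    simp only [map_mul, map_pow]
    ring
  -- The value does not depend on the chosen fraction.
  have key : ∀ z : A, ∃ w : A, ∀ n a, algebraMap R A (σ (x ^ n)) * z = algebraMap R A a →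
      algebraMap R A (x ^ n) * w = algebraMap R A (ψ a) := by
    intro z
    obtain ⟨n, a, h⟩ := hden z
    obtain ⟨w, hw⟩ := (hx n).exists_right_inv
    refine ⟨w * algebraMap R A (ψ a), fun m b hb => ?_⟩
    have h1 : algebraMap R A (σ (x ^ m) * a) = algebraMap R A (σ (x ^ n) * b) := by
      rw [map_mul, map_mul, ← h, ← hb]
      ring
    obtain ⟨k, hk⟩ := IsLocalization.Away.exists_of_eq x h1
    have h2 : σ (x ^ k * x ^ m) * a = σ (x ^ k * x ^ n) * b := by
      have h3 : σ (x ^ k) = x ^ (p * k - k) * x ^ k := by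
        rw [map_pow, hσ, ← pow_mul, ← pow_add, Nat.sub_add_cancel (Nat.le_mul_of_pos_left k hp)]
      rw [map_mul, map_mul, h3]
      linear_combination x ^ (p * k - k) * hk
    have h4 := congrArg ψ h2
    rw [hψ, hψ] at h4
    have h5 := congrArg (algebraMap R A) h4
    rw [map_mul, map_mul, map_mul, map_mul, mul_assoc, mul_assoc] at h5
    have h6 := (hx k).mul_left_cancel h5
    linear_combination w * h6 + algebraMap R A (ψ b) * hw
  choose Ψ hΨ using key
  refine ⟨AddMonoidHom.mk' Ψ fun z w => ?_, fun a => ?_, fun z b => ?_⟩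
  · obtain ⟨n, a, ha⟩ := hden z
    obtain ⟨m, b, hb⟩ := hden w
    have h1 := hΨ z (n + m) (σ (x ^ m) * a) (by rw [map_mul, ← ha, pow_add, map_mul, map_mul]; ring)
    have h2 := hΨ w (n + m) (σ (x ^ n) * b) (by rw [map_mul, ← hb, pow_add, map_mul, map_mul]; ring)
    have h3 := hΨ (z + w) (n + m) (σ (x ^ m) * a + σ (x ^ n) * b) (by
      rw [map_add, map_mul, map_mul, ← ha, ← hb, pow_add, map_mul, map_mul]; ring)
    refine (hx (n + m)).mul_left_cancel ?_
    rw [h3, mul_add, h1, h2, map_add, map_add]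
  · simpa using hΨ (algebraMap R A a) 0 a (by simp)
  · change Ψ (τ z * b) = z * Ψ b
    obtain ⟨n, a, ha⟩ := IsLocalization.Away.surj x z
    obtain ⟨m, c, hc⟩ := hden b
    have h1 := hΨ b m c hc
    have h2 := hΨ (τ z * b) (n + m) (σ a * c) (by
      rw [map_mul, ← hc, ← hτ a, ← ha, pow_add, map_mul, map_mul, map_mul]
      simp only [map_pow, hτ]
      ring)
    refine (hx (n + m)).mul_left_cancel ?_
    rw [h2, hψ, map_mul, ← h1, ← ha, pow_add, map_mul]
    simp only [map_pow]
    ring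

end Splitting

/-! ### Linearisations of semilinear maps -/

section Linearization

variable {R S M N : Type*} [CommRing R] [CommRing S] [AddCommGroup M]
    [AddCommGroup N] [Module R M] [Module S N] {σ : R →+* S} {f : M →ₛₗ[σ] N}

theorem LinearizationIsIso.exists_splitting (h : LinearizationIsIso f) (ψ : S →+ R)
    (hψ : ∀ r s, ψ (σ r * s) = r * ψ s) :
    ∃ Ψ : N →+ M, ∀ s m, Ψ (s • f m) = ψ s • m := by
  let : Algebra R S := σ.toAlgebra
  let : Module R N := Module.compHom N σ
  have : IsScalarTower R S N := ⟨fun r s x => mul_smul (σ r) s x⟩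
  let g : M →ₗ[R] N :=
    { toFun := f
      map_add' := map_add f
      map_smul' := fun r m => f.map_smulₛₗ r m }
  have hg : IsBaseChange S g := h
  let ψ' : S →ₗ[R] R :=
    { toFun := ψ
      map_add' := map_add ψ
      map_smul' := fun r s => by
        rw [Algebra.smul_def]
        exact hψ r s }
  let Θ : TensorProduct R S M →ₗ[R] M :=
    TensorProduct.lift (LinearMap.lsmul R M ∘ₗ ψ')
  refine ⟨Θ.toAddMonoidHom.comp hg.equiv.symm.toLinearMap.toAddMonoidHom, fun s m => ?_⟩
  have h1 : hg.equiv.symm (s • f m) = s ⊗ₜ[R] m := by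
    rw [LinearEquiv.symm_apply_eq, hg.equiv_tmul]
    rfl
  change Θ (hg.equiv.symm (s • f m)) = _
  rw [h1]
  rfl

theorem LinearizationIsIso.span_range (h : LinearizationIsIso f) :
    Submodule.span S (Set.range f) = ⊤ := by
  let : Algebra R S := σ.toAlgebra
  let : Module R N := Module.compHom N σ
  have : IsScalarTower R S N := ⟨fun r s x => mul_smul (σ r) s x⟩
  let g : M →ₗ[R] N :=
    { toFun := f
      map_add' := map_add f
      map_smul' := fun r m => f.map_smulₛₗ r m }
  have hg : IsBaseChange S g := h
  refine eq_top_iff.2 fun y _ => ?_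
  obtain ⟨t, rfl⟩ := hg.equiv.surjective y
  induction t with
  | zero => simp
  | add a b ha hb => rw [map_add]; exact add_mem (ha trivial) (hb trivial)
  | tmul s m =>
    rw [hg.equiv_tmul]
    exact Submodule.smul_mem _ _ (Submodule.subset_span ⟨m, rfl⟩)

theorem LinearizationIsIso.span_range_comp (h : LinearizationIsIso f) {ι : Type*} {e : ι → M}
    (he : Submodule.span R (Set.range e) = ⊤) :
    Submodule.span S (Set.range fun i => f (e i)) = ⊤ := by
  rw [eq_top_iff, ← h.span_range, Submodule.span_le]
  rintro _ ⟨m, rfl⟩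
  have hm : m ∈ Submodule.span R (Set.range e) := he ▸ trivial
  induction hm using Submodule.span_induction with
  | mem _ hx =>
    obtain ⟨i, rfl⟩ := hx
    exact Submodule.subset_span ⟨i, rfl⟩
  | zero => simp
  | add _ _ _ _ ha hb => rw [map_add]; exact add_mem ha hb
  | smul r _ _ hx => rw [LinearMap.map_smulₛₗ]; exact Submodule.smul_mem _ _ hx

end Linearization

/-! ### Lattices in modules over a localization -/

section Lattice

variable {R A D : Type*} [CommRing R] [CommRing A] [Algebra R A] [AddCommGroup D] [Module R D]
  [Module A D] [IsScalarTower R A D]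

theorem exists_pow_smul_mem_span (x : R) [IsLocalization.Away x A] {s : Set D}
    (hs : Submodule.span A s = ⊤) (y : D) : ∃ n : ℕ, x ^ n • y ∈ Submodule.span R s := by
  obtain ⟨⟨_, n, rfl⟩, h⟩ :=
    multiple_mem_span_of_mem_localization_span (Submonoid.powers x) A s y (hs ▸ trivial)
  exact ⟨n, h⟩

theorem exists_pow_smul_mem_of_finite {x : R} {L : Submodule R D} {ι : Type*} [Finite ι] (v : ι → D)
    (h : ∀ i, ∃ n : ℕ, x ^ n • v i ∈ L) : ∃ n : ℕ, ∀ i, x ^ n • v i ∈ L := by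
  cases nonempty_fintype ι
  choose n hn using h
  refine ⟨∑ i, n i, fun i => ?_⟩
  rw [← Nat.sub_add_cancel (Finset.single_le_sum (fun j _ => Nat.zero_le (n j)) (Finset.mem_univ i)),
    pow_add, mul_smul]
  exact L.smul_mem _ (hn i)

theorem smul_mem_of_mem_span {ρ : R →+* R} {τ : A →+* A}
    (hτ : ∀ a, τ (algebraMap R A a) = algebraMap R A (ρ a)) (f : D →ₛₗ[τ] D) {ι : Type*} {e : ι → D}
    {L : Submodule R D} {c : R} (h : ∀ i, c • f (e i) ∈ L) {y : D}
    (hy : y ∈ Submodule.span R (Set.range e)) : c • f y ∈ L := by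
  induction hy using Submodule.span_induction with
  | mem _ hx =>
    obtain ⟨i, rfl⟩ := hx
    exact h i
  | zero => simp
  | add _ _ _ _ ha hb => rw [map_add, smul_add]; exact add_mem ha hb
  | smul r y _ hx =>
    have : f (r • y) = ρ r • f y := by
      rw [← algebraMap_smul A r y, LinearMap.map_smulₛₗ, hτ, algebraMap_smul]
    rw [this, smul_comm]
    exact L.smul_mem _ hx

theorem smul_injective_of_isUnit {x : R} (hx : IsUnit (algebraMap R A x)) :
    Function.Injective fun y : D => x • y := by
  intro y z h
  simp only [← algebraMap_smul A x] at h
  exact hx.smul_left_cancel.1 h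

/-- The generators give a surjection `A^ι → D`, which is an open quotient map for the module
topology; the basis is the image of the product basis. -/
theorem hasBasis_nhds_zero_of_span_eq_top [TopologicalSpace A] [IsTopologicalRing A]
    [TopologicalSpace D] [IsModuleTopology A D] {ι : Type*} [Finite ι] {e : ι → D}
    (he : Submodule.span A (Set.range e) = ⊤) {x : R}
    (hA : (nhds (0 : A)).HasBasis (fun _ : ℕ => True)
      fun n => Set.range fun a : R => algebraMap R A (x ^ n * a)) :
    (nhds (0 : D)).HasBasis (fun _ : ℕ => True)
      fun n => {y | ∃ z ∈ Submodule.span R (Set.range e), x ^ n • z = y} := by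
  cases nonempty_fintype ι
  let π : (ι → A) →ₗ[A] D := Fintype.linearCombination A e
  have hπ : Function.Surjective π := by
    rw [← LinearMap.range_eq_top, Fintype.range_linearCombination, he]
  have hq := IsModuleTopology.isOpenQuotientMap_of_surjective hπ
  have h0 : nhds (0 : D) = Filter.map π (nhds 0) := by
    rw [hq.map_nhds_eq, map_zero]
  have himg : ∀ n : ℕ, {y | ∃ z ∈ Submodule.span R (Set.range e), x ^ n • z = y} =
      π '' (Set.univ.pi fun _ => Set.range fun a : R => algebraMap R A (x ^ n * a)) := by
    intro n
    ext y
    constructor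
    · rintro ⟨z, hz, rfl⟩
      obtain ⟨c, rfl⟩ := (Submodule.mem_span_range_iff_exists_fun R).1 hz
      refine ⟨fun i => algebraMap R A (x ^ n * c i), fun i _ => ⟨c i, rfl⟩, ?_⟩
      simp only [π, Fintype.linearCombination_apply, algebraMap_smul, Finset.smul_sum, mul_smul]
    · rintro ⟨c, hc, rfl⟩
      choose b hb using fun i => hc i trivial
      refine ⟨∑ i, b i • e i, (Submodule.mem_span_range_iff_exists_fun R).2 ⟨b, rfl⟩, ?_⟩
      simp only [π, Fintype.linearCombination_apply, ← hb, algebraMap_smul, Finset.smul_sum,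
        mul_smul]
  rw [h0, nhds_pi]
  refine ((hA.pi_self (ι := ι)).map π).to_hasBasis ?_ ?_
  · rintro ⟨I, n⟩ -
    refine ⟨n, trivial, ?_⟩
    rw [himg]
    exact Set.image_mono (Set.pi_mono' (fun _ _ => subset_rfl) (Set.subset_univ _))
  · intro n _
    refine ⟨(Set.univ, n), ⟨Set.finite_univ, trivial⟩, ?_⟩
    rw [himg]

end Lattice

/-! ### The Frobenius `φ_s` and its splitting on `E_Δ` -/

section Rings

variable {p : ℕ} {Δ : Type*}

/-- The additive map `∑ a_n X^n ↦ ∑ a_{pn} X^n` on `E_Δ^+`. -/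
def psiPlus (p : ℕ) (Δ : Type*) : EPlus p Δ →+ EPlus p Δ where
  toFun f := fun n => MvPowerSeries.coeff (p • n) f
  map_zero' := rfl
  map_add' _ _ := rfl

theorem coeff_psiPlus (f : EPlus p Δ) (n : Δ →₀ ℕ) :
    MvPowerSeries.coeff n (psiPlus p Δ f) = MvPowerSeries.coeff (p • n) f := rfl

/-- In the convolution for the coefficient at `p • n`, only terms whose first exponent is divisible
by `p` survive, and then so is the second. -/
theorem psiPlus_expand_mul (hp : p ≠ 0) (a b : EPlus p Δ) :
    psiPlus p Δ (MvPowerSeries.expand p hp a * b) = a * psiPlus p Δ b := by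
  classical
  ext n
  rw [coeff_psiPlus, MvPowerSeries.coeff_mul, MvPowerSeries.coeff_mul]
  symm
  have hinj : Function.Injective fun m : Δ →₀ ℕ => p • m := nsmul_right_injective hp
  refine Finset.sum_of_injOn (fun ij => (p • ij.1, p • ij.2)) ?_ ?_ ?_ ?_
  · rintro ⟨i, j⟩ - ⟨k, l⟩ - h
    simp only [Prod.mk.injEq] at h ⊢
    exact ⟨hinj h.1, hinj h.2⟩
  · rintro ⟨i, j⟩ h
    simp only [Finset.mem_coe, Finset.HasAntidiagonal.mem_antidiagonal] at h ⊢
    rw [← smul_add, h]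
  · rintro ⟨u, v⟩ huv hn
    rw [Finset.HasAntidiagonal.mem_antidiagonal] at huv
    by_cases hu : ∀ i, p ∣ u i
    · refine absurd ?_ hn
      have hv : ∀ i, p ∣ v i := fun i => by
        have := DFunLike.congr_fun huv i
        simp only [Finsupp.add_apply, Finsupp.smul_apply, smul_eq_mul] at this
        exact (Nat.dvd_add_right (hu i)).1 (this ▸ dvd_mul_right p (n i))
      have hdiv : ∀ w : Δ →₀ ℕ, (∀ i, p ∣ w i) → p • w.mapRange (· / p) (Nat.zero_div p) = w :=
        fun w hw => Finsupp.ext fun i => by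
          simpa using Nat.mul_div_cancel' (hw i)
      refine ⟨(u.mapRange (· / p) (Nat.zero_div p), v.mapRange (· / p) (Nat.zero_div p)), ?_, ?_⟩
      · rw [Finset.mem_coe, Finset.HasAntidiagonal.mem_antidiagonal]
        apply hinj
        simp only [smul_add]
        rw [hdiv u hu, hdiv v hv, huv]
      · simp only [hdiv u hu, hdiv v hv]
    · push Not at hu
      obtain ⟨i, hi⟩ := hu
      rw [MvPowerSeries.coeff_expand_of_not_dvd p hp a hi, zero_mul]
  · rintro ⟨i, j⟩ -
    rw [MvPowerSeries.coeff_expand_smul, coeff_psiPlus]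

theorem psiPlus_one (hp : p ≠ 0) : psiPlus p Δ 1 = 1 := by
  classical
  ext n
  rw [coeff_psiPlus, MvPowerSeries.coeff_one, MvPowerSeries.coeff_one]
  simp [hp]

variable [hp : Fact p.Prime]

theorem binom_one : binom p 1 = PowerSeries.X := by
  have h := PowerSeries.binomialSeries_nat (R := ℤ_[p]) (A := ℤ_[p]) 1
  rw [Nat.cast_one] at h
  rw [binom, h]
  simp

variable [Fintype Δ]

theorem sigmaPlus_phiS :
    sigmaPlus (phiS p Δ) = (MvPowerSeries.expand p hp.out.ne_zero).toRingHom := by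
  have h : imageX (phiS p Δ) = fun α => (MvPowerSeries.X α : EPlus p Δ) ^ p := by
    funext α
    simp only [imageX, phiS, Units.val_one, binom_one, toAdd_ofAdd, pow_one]
    rw [PowerSeries.subst_X (PowerSeries.HasSubst.of_constantCoeff_zero
      (MvPowerSeries.constantCoeff_X α))]
  ext1 a
  change MvPowerSeries.substAlgHom (R := ZMod p) _ a = MvPowerSeries.substAlgHom _ a
  rw [MvPowerSeries.substAlgHom_apply, MvPowerSeries.substAlgHom_apply, h]

theorem sigmaPlus_phiS_apply (a : EPlus p Δ) : sigmaPlus (phiS p Δ) a = a ^ p := by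
  rw [sigmaPlus_phiS, ← MvPowerSeries.map_frobenius_expand p hp.out.ne_zero,
    ZMod.frobenius_zmod, MvPowerSeries.map_id]
  rfl

theorem sigma_algebraMap (t : TPlus p Δ) (a : EPlus p Δ) :
    sigma t (algebraMap (EPlus p Δ) (E p Δ) a) = algebraMap (EPlus p Δ) (E p Δ) (sigmaPlus t a) :=
  IsLocalization.Away.lift_eq _ _ _

theorem XΔ_dvd_sigmaPlus (t : TPlus p Δ) : XΔ p Δ ∣ sigmaPlus t (XΔ p Δ) := by
  rw [XΔ, map_prod]
  refine Finset.prod_dvd_prod_of_dvd _ _ fun α _ => ?_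
  obtain ⟨v, -, hv⟩ := exists_imageX_eq t α
  have h : sigmaPlus t (MvPowerSeries.X α) = imageX t α :=
    MvPowerSeries.substAlgHom_X (hasSubst_imageX t) α
  rw [h, hv]
  exact (dvd_mul_right _ _).trans (dvd_pow_self _ (pow_ne_zero _ hp.out.ne_zero))

/-- The Frobenius `φ_s` of `E_Δ` has a `φ_s⁻¹`-linear left inverse that preserves `E_Δ^+`. -/
theorem exists_psi (p : ℕ) [Fact p.Prime] (Δ : Type*) [Fintype Δ] :
    ∃ Ψ : E p Δ →+ E p Δ, Ψ 1 = 1 ∧ (∀ z b, Ψ (sigma (phiS p Δ) z * b) = z * Ψ b) ∧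
      ∀ a : EPlus p Δ, Ψ (algebraMap (EPlus p Δ) (E p Δ) a) =
        algebraMap (EPlus p Δ) (E p Δ) (psiPlus p Δ a) := by
  have hp : p.Prime := Fact.out
  obtain ⟨Ψ, h1, h2⟩ := exists_splitting_localization (XΔ p Δ) (A := E p Δ) hp.one_le
    (sigmaPlus_phiS_apply (XΔ p Δ)) (sigma_algebraMap (phiS p Δ)) (psiPlus p Δ) (fun a b => by
      rw [sigmaPlus_phiS]
      exact psiPlus_expand_mul hp.ne_zero a b)
  refine ⟨Ψ, ?_, h2, h1⟩
  have h := h1 1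
  rwa [psiPlus_one hp.ne_zero, map_one] at h

end Rings

/-! ### The lattice spanned by a system of generators -/

namespace EtaleModule

variable {p : ℕ} [hp : Fact p.Prime] {Δ : Type*} [Fintype Δ] {D : Type*} [AddCommGroup D]
  [Module (E p Δ) D]

theorem iterate_φ_phiS_comm (S : EtaleModule p Δ D) (t : TPlus p Δ) (k : ℕ) (x : D) :
    (S.φ (phiS p Δ))^[k] (S.φ t x) = S.φ t ((S.φ (phiS p Δ))^[k] x) := by
  have h : Function.Commute (S.φ (phiS p Δ)) (S.φ t) := fun y => by
    rw [← S.φ_mul, ← S.φ_mul, mul_comm]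
  exact h.iterate_left k x

variable [Module (EPlus p Δ) D] [IsScalarTower (EPlus p Δ) (E p Δ) D]

theorem φ_smul (S : EtaleModule p Δ D) (t : TPlus p Δ) (a : EPlus p Δ) (x : D) :
    S.φ t (a • x) = sigmaPlus t a • S.φ t x := by
  rw [← algebraMap_smul (E p Δ) a x, LinearMap.map_smulₛₗ, sigma_algebraMap, algebraMap_smul]

theorem φ_phiS_smul (S : EtaleModule p Δ D) (a : EPlus p Δ) (x : D) :
    S.φ (phiS p Δ) (a • x) = a ^ p • S.φ (phiS p Δ) x := by
  rw [φ_smul, sigmaPlus_phiS_apply]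

theorem iterate_φ_phiS_smul (S : EtaleModule p Δ D) (k : ℕ) (a : EPlus p Δ) (x : D) :
    (S.φ (phiS p Δ))^[k] (a • x) = a ^ p ^ k • (S.φ (phiS p Δ))^[k] x := by
  induction k with
  | zero => simp
  | succ k ih => rw [Function.iterate_succ_apply', ih, φ_phiS_smul, Function.iterate_succ_apply',
      pow_succ, pow_mul]

theorem hasBasis_nhds_zero {ι : Type*} [Finite ι] {e : ι → D}
    (he : Submodule.span (E p Δ) (Set.range e) = ⊤) :
    (@nhds D (topModule p Δ D) 0).HasBasis (fun _ : ℕ => True)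
      fun n => {y | ∃ z ∈ Submodule.span (EPlus p Δ) (Set.range e), XΔ p Δ ^ n • z = y} := by
  let := topE p Δ
  let := topModule p Δ D
  have : IsTopologicalRing (E p Δ) :=
    (powSubgroup_basis p Δ).toRingFilterBasis.isTopologicalRing
  have : IsModuleTopology (E p Δ) D := ⟨rfl⟩
  refine hasBasis_nhds_zero_of_span_eq_top he ?_
  convert (powSubgroup_basis p Δ).hasBasis_nhds_zero using 2 with n
  ext x
  rw [SetLike.mem_coe, mem_powSubgroup]
  exact exists_congr fun a => eq_comm

theorem mem_plusPlus_iff (S : EtaleModule p Δ D) {ι : Type*} [Finite ι] {e : ι → D}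
    (he : Submodule.span (E p Δ) (Set.range e) = ⊤) (x : D) :
    x ∈ S.plusPlus ↔ ∀ n : ℕ, ∃ K : ℕ, ∀ k ≥ K,
      ∃ z ∈ Submodule.span (EPlus p Δ) (Set.range e),
        XΔ p Δ ^ n • z = (S.φ (phiS p Δ))^[k] x := by
  change Tendsto _ _ _ ↔ _
  rw [(hasBasis_nhds_zero he).tendsto_right_iff]
  simp

theorem exists_pow_smul_φ_mem (S : EtaleModule p Δ D) (t : TPlus p Δ) {ι : Type*} [Finite ι]
    {e : ι → D} (he : Submodule.span (E p Δ) (Set.range e) = ⊤) :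
    ∃ N : ℕ, ∀ y ∈ Submodule.span (EPlus p Δ) (Set.range e),
      XΔ p Δ ^ N • S.φ t y ∈ Submodule.span (EPlus p Δ) (Set.range e) := by
  obtain ⟨N, hN⟩ := exists_pow_smul_mem_of_finite (fun i => S.φ t (e i))
    fun i => exists_pow_smul_mem_span (A := E p Δ) (XΔ p Δ) he (S.φ t (e i))
  exact ⟨N, fun y hy => smul_mem_of_mem_span (sigma_algebraMap t) (S.φ t) hN hy⟩

/-- The operator `ψ` on `D`: an additive left inverse of `φ_s` preserving a lattice. -/
theorem exists_psi_lattice (S : EtaleModule p Δ D) {ι : Type*} [Finite ι]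
    {e : ι → D} (he : Submodule.span (E p Δ) (Set.range e) = ⊤) :
    ∃ (Ψ : D →+ D) (M : ℕ), (∀ x, Ψ (S.φ (phiS p Δ) x) = x) ∧
      ∀ y, XΔ p Δ ^ M • y ∈ Submodule.span (EPlus p Δ) (Set.range e) →
        XΔ p Δ ^ M • Ψ y ∈ Submodule.span (EPlus p Δ) (Set.range e) := by
  obtain ⟨ψ, hψ1, hψσ, hψ⟩ := exists_psi p Δ
  obtain ⟨Ψ, hΨ⟩ := (S.etale (phiS p Δ)).exists_splitting ψ hψσ
  -- `Ψ` is only controlled on elements `s • φ_s m`; by étaleness these generate `D` additively.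
  have hΨσ : ∀ (a : EPlus p Δ) y, Ψ (a ^ p • y) = a • Ψ y := by
    intro a y
    have hy : y ∈ Submodule.span (E p Δ) (Set.range (S.φ (phiS p Δ))) :=
      (S.etale (phiS p Δ)).span_range ▸ trivial
    obtain ⟨c, rfl⟩ := Finsupp.mem_span_range_iff_exists_finsupp.1 hy
    simp only [Finsupp.sum, Finset.smul_sum, map_sum]
    refine Finset.sum_congr rfl fun m _ => ?_
    rw [← algebraMap_smul (E p Δ) (a ^ p), smul_smul, hΨ, hΨ, ← sigmaPlus_phiS_apply,
      ← sigma_algebraMap, hψσ, mul_smul, algebraMap_smul]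
  have he' := (S.etale (phiS p Δ)).span_range_comp he
  obtain ⟨M, hM⟩ := exists_pow_smul_mem_of_finite e
    fun i => exists_pow_smul_mem_span (A := E p Δ) (XΔ p Δ) he' (e i)
  have hML : ∀ y ∈ Submodule.span (EPlus p Δ) (Set.range e), XΔ p Δ ^ M • y ∈
      Submodule.span (EPlus p Δ) (Set.range fun i => S.φ (phiS p Δ) (e i)) := by
    intro y hy
    induction hy using Submodule.span_induction with
    | mem _ hx =>
      obtain ⟨i, rfl⟩ := hx
      exact hM i
    | zero => simp
    | add _ _ _ _ ha hb => rw [smul_add]; exact add_mem ha hb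
    | smul r y _ hx => rw [smul_comm]; exact Submodule.smul_mem _ _ hx
  have hΨL : ∀ y ∈ Submodule.span (EPlus p Δ) (Set.range fun i => S.φ (phiS p Δ) (e i)),
      Ψ y ∈ Submodule.span (EPlus p Δ) (Set.range e) := by
    cases nonempty_fintype ι
    intro y hy
    obtain ⟨c, rfl⟩ := (Submodule.mem_span_range_iff_exists_fun _).1 hy
    rw [map_sum]
    refine Submodule.sum_mem _ fun i _ => ?_
    rw [← algebraMap_smul (E p Δ) (c i), hΨ, hψ, algebraMap_smul]
    exact Submodule.smul_mem _ _ (Submodule.subset_span ⟨i, rfl⟩)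
  refine ⟨Ψ, M, fun x => ?_, fun y hy => ?_⟩
  · rw [← one_smul (E p Δ) (S.φ (phiS p Δ) x), hΨ, hψ1, one_smul]
  · rw [← hΨσ]
    -- As `p ≥ 2`, two factors `X_Δ^M` are available: one brings `y` into `L`, the other brings `L`
    -- into the span of the `φ_s (e i)`.
    have h2 : (XΔ p Δ ^ M) ^ p = (XΔ p Δ ^ M) ^ (p - 2) * (XΔ p Δ ^ M * XΔ p Δ ^ M) := by
      rw [← sq, ← pow_add, Nat.sub_add_cancel hp.out.two_le]
    rw [h2, mul_smul, mul_smul]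
    exact hΨL _ (Submodule.smul_mem _ _ (hML _ hy))

theorem exists_pow_smul_mem_of_mem_plusPlus (S : EtaleModule p Δ D) {ι : Type*} [Finite ι]
    {e : ι → D} (he : Submodule.span (E p Δ) (Set.range e) = ⊤) :
    ∃ M : ℕ, ∀ x ∈ S.plusPlus,
      XΔ p Δ ^ M • x ∈ Submodule.span (EPlus p Δ) (Set.range e) := by
  obtain ⟨Ψ, M, hΨ, hM⟩ := S.exists_psi_lattice he
  refine ⟨M, fun x hx => ?_⟩
  -- A single iterate lying in `L` is enough.
  obtain ⟨K, hK⟩ := (S.mem_plusPlus_iff he x).1 hx 0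
  obtain ⟨z, hz, hzx⟩ := hK K le_rfl
  have hdesc : ∀ k, XΔ p Δ ^ M • (S.φ (phiS p Δ))^[k] x ∈
      Submodule.span (EPlus p Δ) (Set.range e) →
      XΔ p Δ ^ M • x ∈ Submodule.span (EPlus p Δ) (Set.range e) := by
    intro k
    induction k with
    | zero => exact id
    | succ k ih =>
      intro h
      rw [Function.iterate_succ_apply'] at h
      have := hM _ h
      rw [hΨ] at this
      exact ih this
  refine hdesc K ?_
  rw [← hzx]
  exact Submodule.smul_mem _ _ (Submodule.smul_mem _ _ hz)

theorem exists_pow_smul_mem_plusPlus (S : EtaleModule p Δ D) {ι : Type*} [Finite ι]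
    {e : ι → D} (he : Submodule.span (E p Δ) (Set.range e) = ⊤) :
    ∃ N : ℕ, ∀ y ∈ Submodule.span (EPlus p Δ) (Set.range e), XΔ p Δ ^ N • y ∈ S.plusPlus := by
  obtain ⟨N, hN⟩ := S.exists_pow_smul_φ_mem (phiS p Δ) he
  -- With `N + 1` rather than `N`, multiplying the exponent by `p ≥ 2` and losing `N` still gains at
  -- least one at each step.
  refine ⟨N + 1, fun y hy => (S.mem_plusPlus_iff he _).2 fun n => ⟨n, fun k hk => ?_⟩⟩
  have key : ∀ k : ℕ, ∃ z ∈ Submodule.span (EPlus p Δ) (Set.range e),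
      XΔ p Δ ^ (N + 1 + k) • z = (S.φ (phiS p Δ))^[k] (XΔ p Δ ^ (N + 1) • y) := by
    intro k
    induction k with
    | zero => exact ⟨y, hy, rfl⟩
    | succ k ih =>
      obtain ⟨z, hz, h⟩ := ih
      have hexp : (N + 1 + k) * p = (N + 1 + (k + 1)) + ((N + 1 + k) * (p - 2) + k) + N := by
        obtain ⟨q, rfl⟩ := Nat.exists_eq_add_of_le hp.out.two_le
        rw [Nat.add_sub_cancel_left]
        ring
      refine ⟨XΔ p Δ ^ ((N + 1 + k) * (p - 2) + k) • XΔ p Δ ^ N • S.φ (phiS p Δ) z,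
        Submodule.smul_mem _ _ (hN z hz), ?_⟩
      rw [Function.iterate_succ_apply', ← h, φ_phiS_smul, smul_smul, smul_smul, ← pow_add,
        ← pow_add, ← pow_mul, hexp]
  obtain ⟨z, hz, h⟩ := key k
  refine ⟨XΔ p Δ ^ (N + 1 + k - n) • z, Submodule.smul_mem _ _ hz, ?_⟩
  rw [← h, smul_smul, ← pow_add]
  congr 2
  omega

theorem φ_mem_plusPlus (S : EtaleModule p Δ D) {ι : Type*} [Finite ι]
    {e : ι → D} (he : Submodule.span (E p Δ) (Set.range e) = ⊤) (t : TPlus p Δ) {x : D}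
    (hx : x ∈ S.plusPlus) : S.φ t x ∈ S.plusPlus := by
  obtain ⟨N, hN⟩ := S.exists_pow_smul_φ_mem t he
  obtain ⟨w, hw⟩ := XΔ_dvd_sigmaPlus t
  rw [S.mem_plusPlus_iff he] at hx ⊢
  intro n
  -- The extra `N` pays for the denominator that `φ_t` introduces on `L`.
  obtain ⟨K, hK⟩ := hx (n + N)
  refine ⟨K, fun k hk => ?_⟩
  obtain ⟨z, hz, h⟩ := hK k hk
  refine ⟨w ^ (n + N) • XΔ p Δ ^ N • S.φ t z, Submodule.smul_mem _ _ (hN z hz), ?_⟩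
  rw [iterate_φ_phiS_comm, ← h, φ_smul, map_pow, hw, smul_smul, smul_smul]
  congr 1
  ring

/-- `D^{++}` as an `E_Δ^+`-submodule of `D`. -/
def plusPlusSubmodule (S : EtaleModule p Δ D) {ι : Type*} [Finite ι]
    {e : ι → D} (he : Submodule.span (E p Δ) (Set.range e) = ⊤) : Submodule (EPlus p Δ) D where
  carrier := S.plusPlus
  zero_mem' := by
    refine (S.mem_plusPlus_iff he _).2 fun n => ⟨0, fun k _ => ⟨0, zero_mem _, ?_⟩⟩
    rw [smul_zero, iterate_map_zero]
  add_mem' := by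
    intro x y hx hy
    rw [S.mem_plusPlus_iff he] at hx hy ⊢
    intro n
    obtain ⟨K, hK⟩ := hx n
    obtain ⟨K', hK'⟩ := hy n
    refine ⟨max K K', fun k hk => ?_⟩
    obtain ⟨z, hz, h⟩ := hK k (le_of_max_le_left hk)
    obtain ⟨z', hz', h'⟩ := hK' k (le_of_max_le_right hk)
    exact ⟨z + z', add_mem hz hz', by rw [smul_add, h, h', iterate_map_add]⟩
  smul_mem' := by
    intro a x hx
    rw [S.mem_plusPlus_iff he] at hx ⊢
    intro n
    obtain ⟨K, hK⟩ := hx n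
    refine ⟨K, fun k hk => ?_⟩
    obtain ⟨z, hz, h⟩ := hK k hk
    exact ⟨a ^ p ^ k • z, Submodule.smul_mem _ _ hz, by
      rw [iterate_φ_phiS_smul, ← h, smul_comm]⟩

theorem plusPlusSubmodule_fg (S : EtaleModule p Δ D) {ι : Type*} [Finite ι]
    {e : ι → D} (he : Submodule.span (E p Δ) (Set.range e) = ⊤) :
    (S.plusPlusSubmodule he).FG := by
  obtain ⟨M, hM⟩ := S.exists_pow_smul_mem_of_mem_plusPlus he
  have hinj : Function.Injective (LinearMap.lsmul (EPlus p Δ) D (XΔ p Δ ^ M)) :=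
    smul_injective_of_isUnit (A := E p Δ) (by
      rw [map_pow]
      exact (IsLocalization.Away.algebraMap_isUnit (XΔ p Δ)).pow M)
  refine Submodule.fg_of_fg_map_injective _ hinj ?_
  have hL : (Submodule.span (EPlus p Δ) (Set.range e)).FG :=
    Submodule.fg_span (Set.finite_range e)
  refine Submodule.FG.of_le hL ?_
  rintro _ ⟨x, hx, rfl⟩
  exact hM x hx

theorem isLocalizedModule_plusPlusSubmodule (S : EtaleModule p Δ D) {ι : Type*} [Finite ι]
    {e : ι → D} (he : Submodule.span (E p Δ) (Set.range e) = ⊤) :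
    IsLocalizedModule (Submonoid.powers (XΔ p Δ)) (S.plusPlusSubmodule he).subtype where
  map_units := by
    intro s
    have h := (IsLocalization.map_units (E p Δ) s).map
      (Algebra.lsmul (EPlus p Δ) (EPlus p Δ) D : E p Δ →ₐ[EPlus p Δ] _)
    rwa [AlgHom.commutes] at h
  surj y := by
    obtain ⟨N, hN⟩ := S.exists_pow_smul_mem_plusPlus he
    obtain ⟨n, hn⟩ := exists_pow_smul_mem_span (XΔ p Δ) he y
    refine ⟨(⟨XΔ p Δ ^ N • XΔ p Δ ^ n • y, hN _ hn⟩, ⟨XΔ p Δ ^ (N + n), N + n, rfl⟩), ?_⟩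
    change XΔ p Δ ^ (N + n) • y = XΔ p Δ ^ N • XΔ p Δ ^ n • y
    rw [pow_add, mul_smul]
  exists_of_eq h := ⟨1, congrArg _ (Subtype.ext h)⟩

end EtaleModule

end MultiPhiGamma
end

open MultiPhiGamma

theorem mainTheorem7 (p : ℕ) [Fact p.Prime] (Δ : Type*) [Fintype Δ]
    (D : Type*) [AddCommGroup D] [Module (E p Δ) D]
    [Module (EPlus p Δ) D] [IsScalarTower (EPlus p Δ) (E p Δ) D]
    (S : EtaleModule p Δ D) :
    ∃ M : Submodule (EPlus p Δ) D,
      (M : Set D) = S.plusPlus ∧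
      M.FG ∧
      (∀ t : TPlus p Δ, ∀ x ∈ M, S.φ t x ∈ M) ∧
      IsLocalizedModule (Submonoid.powers (XΔ p Δ)) M.subtype := by
  have := S.finite
  obtain ⟨n, e, he⟩ := Module.Finite.exists_fin (R := E p Δ) (M := D)
  exact ⟨S.plusPlusSubmodule he, rfl, S.plusPlusSubmodule_fg he,
    fun t x hx => S.φ_mem_plusPlus he t hx, S.isLocalizedModule_plusPlusSubmodule he⟩
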